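/- Let $\mathbb H$ be the real quaternions and $\mathbb B=\{p\in\mathbb H:|p|<1\}$. A function $f:\mathbb B\to\mathbb H$ is called (left) slice regular on $\mathbb B$ if it is real differentiable and, for every purely imaginary unit quaternion $I$, $$\frac{\partial}{\partial x}f(x+Iy)+I\,\frac{\partial}{\partial y}f(x+Iy)=0\qquad\text{for all real } x,y \text{ with } x+Iy\in\mathbb B;$$ every such $f$ has a unique expansion $f(p)=\sum_{k\ge 0}p^kf_k$ on $\mathbb B$ with $f_k\in\mathbb H$. Let $$\mathrm H^2=\Big\{f(p)=\sum_{k\ge 0}p^kf_k\ (p\in\mathbb B):\ \|f\|_{\mathrm H^2}^2:=\sum_{k\ge 0}|f_k|^2<\infty\Big\}.$$ For an arbitrary function $S:\mathbb B\to\mathbb H$ and $f(p)=\sum_k p^kf_k\in\mathrm H^2$ put $$(S\star f)(p)=\sum_{k\ge 0}p^kS(p)f_k\qquad(p\in\mathbb B).$$ **Theorem.** Let $S:\mathbb B\to\mathbb H$. The following are equivalent: 1. $S$ is slice regular on $\mathbb B$ and $|S(p)|\le 1$ for all $p\in\mathbb B$. 2. The operator $M_S:f\mapsto S\star f$ maps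 $\mathrm H^2$ into itself and is a contraction: $\|S\star f\|_{\mathrm H^2}\le\|f\|_{\mathrm H^2}$ for all $f\in\mathrm H^2$. 3. The kernel $K_S(p,q)=\sum_{k\ge 0}p^k\big(1-S(p)\overline{S(q)}\big)\bar q^{\,k}$ is positive on $\mathbb B\times\mathbb B$, that is, for every $r\in\mathbb N$ and all $q_1,\dots,q_r\in\mathbb B$ the quaternionic matrix $[K_S(q_i,q_j)]_{i,j=1}^r$ is positive semidefinite (Hermitian with $c^*[K_S(q_i,q_j)]c\ge 0$ for all $c\in\mathbb H^r$). 4. $S$ is slice regular on $\mathbb B$ and, with $S(p)=\sum_{k\ge 0}p^kS_k$, for every $n\ge 0$ the $(n+1)\times(n+1)$ matrix $\mathbf I-\mathbf S_n\mathbf S_n^*$ is positive semidefinite, where $\mathbf S_n$ is the lower triangular Toeplitz matrix whose $(i,j)$ entry ($0\le i,j\le n$) is $S_{i-j}$ if $i\ge j$ and $0$ otherwise. In particular, a slice regular function $S$ on $\mathbb B$ satisfies $|S|\le 1$ on $\mathbb B$ if and only if $\mathbf I-\mathbf S_n\mathbf S_n^*\ge 0$ for all $n\ge 0$ (equivalence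 of 1 and 4). -/

import Mathlib

open scoped Quaternion Topology

noncomputable section

namespace QuatHardy

/-- The open unit ball of the quaternions. -/
def unitBall : Set ℍ[ℝ] := Metric.ball 0 1

/-- The unit sphere of purely imaginary quaternions. -/
def imagSphere : Set ℍ[ℝ] := {I | I.re = 0 ∧ ‖I‖ = 1}

/-- A function `f` is (left) slice regular on a set `Ω` (meant for open `Ω`) if it is real
differentiable there and, for every imaginary unit `I`, its restriction to the complex plane
`ℝ + Iℝ` satisfies `∂f/∂x (x + I y) + I ∂f/∂y (x + I y) = 0`. Only the values of `f` on the open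
set `Ω` matter. -/
def SliceRegularOn (f : ℍ[ℝ] → ℍ[ℝ]) (Ω : Set ℍ[ℝ]) : Prop :=
  (∀ p ∈ Ω, DifferentiableAt ℝ f p) ∧
    ∀ I ∈ imagSphere, ∀ x y : ℝ, (x : ℍ[ℝ]) + I * (y : ℍ[ℝ]) ∈ Ω →
      deriv (fun t : ℝ => f ((t : ℍ[ℝ]) + I * (y : ℍ[ℝ]))) x
        + I * deriv (fun t : ℝ => f ((x : ℍ[ℝ]) + I * (t : ℍ[ℝ]))) y = 0

/-- `f(p) = ∑ p ^ k a_k` for all `p` in the unit ball. -/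
def HasExpansion (f : ℍ[ℝ] → ℍ[ℝ]) (a : ℕ → ℍ[ℝ]) : Prop :=
  ∀ p ∈ unitBall, HasSum (fun k : ℕ => p ^ k * a k) (f p)

/-- The coefficients of a power series expansion on the unit ball are unique. -/
theorem HasExpansion.unique {f : ℍ[ℝ] → ℍ[ℝ]} {a b : ℕ → ℍ[ℝ]}
    (ha : HasExpansion f a) (hb : HasExpansion f b) : a = b := by
  have key : ∀ c : ℕ → ℍ[ℝ], HasExpansion f c →
      HasFPowerSeriesAt (fun t : ℝ => f (t : ℍ[ℝ]))
        (fun k => ContinuousMultilinearMap.mkPiRing ℝ (Fin k) (c k) :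
          FormalMultilinearSeries ℝ ℝ ℍ[ℝ]) 0 := by
    intro c hc
    refine hasFPowerSeriesAt_iff.2 ?_
    filter_upwards [Metric.ball_mem_nhds (0 : ℝ) one_pos] with t ht
    have h1 : (t : ℍ[ℝ]) ∈ unitBall := by
      simpa [unitBall, Quaternion.norm_coe] using ht
    have h2 := hc _ h1
    have e : (fun k : ℕ => (t : ℍ[ℝ]) ^ k * c k) = fun k => t ^ k • c k := by
      funext k
      rw [← Quaternion.coe_pow, Quaternion.coe_mul_eq_smul]
    rw [e] at h2
    simpa [FormalMultilinearSeries.coeff] using h2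
  have h := (key a ha).eq_formalMultilinearSeries (key b hb)
  funext k
  have h3 := congrArg (fun p : FormalMultilinearSeries ℝ ℝ ℍ[ℝ] => p.coeff k) h
  simpa [FormalMultilinearSeries.coeff] using h3

open Classical in
/-- The Taylor coefficients `f_k` of a function with an expansion `f(p) = ∑ p ^ k f_k` on the unit
ball (and `0` if there is no expansion). -/
def coeff (f : ℍ[ℝ] → ℍ[ℝ]) : ℕ → ℍ[ℝ] :=
  if h : ∃ a, HasExpansion f a then h.choose else 0

theorem HasExpansion.coeff_eq {f : ℍ[ℝ] → ℍ[ℝ]} {a : ℕ → ℍ[ℝ]} (ha : HasExpansion f a) :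
    coeff f = a := by
  have h : ∃ a, HasExpansion f a := ⟨a, ha⟩
  rw [coeff, dif_pos h]
  exact h.choose_spec.unique ha

/-- Membership in the quaternionic Hardy space: `f(p) = ∑ p ^ k f_k` on the unit ball, with
`∑ |f_k| ^ 2 < ∞`. -/
def MemHardy (f : ℍ[ℝ] → ℍ[ℝ]) : Prop :=
  ∃ a : ℕ → ℍ[ℝ], HasExpansion f a ∧ Summable (fun k => ‖a k‖ ^ 2)

/-- The Hardy norm `(∑ |f_k| ^ 2) ^ (1/2)` of a member of the Hardy space. -/
def hardyNorm (f : ℍ[ℝ] → ℍ[ℝ]) : ℝ := √(∑' k, ‖coeff f k‖ ^ 2)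

/-- Left `⋆`-multiplication by an arbitrary function `S`:
`(S ⋆ f)(p) = ∑ p ^ k S(p) f_k` where `f(p) = ∑ p ^ k f_k`. -/
def starMul (S f : ℍ[ℝ] → ℍ[ℝ]) : ℍ[ℝ] → ℍ[ℝ] :=
  fun p => ∑' k : ℕ, p ^ k * S p * coeff f k

/-- Left `⋆`-multiplication by `S` maps the Hardy space into itself and is a contraction. -/
def IsContractiveMultiplier (S : ℍ[ℝ] → ℍ[ℝ]) : Prop :=
  ∀ f, MemHardy f → MemHardy (starMul S f) ∧ hardyNorm (starMul S f) ≤ hardyNorm f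

/-- A quaternionic matrix is positive semidefinite if it is Hermitian and `x* A x ≥ 0` for all
vectors `x` (for Hermitian `A` the quaternion `x* A x` is real). -/
def IsPosSemidef {n : ℕ} (A : Matrix (Fin n) (Fin n) ℍ[ℝ]) : Prop :=
  A.IsHermitian ∧ ∀ x : Fin n → ℍ[ℝ], 0 ≤ (star x ⬝ᵥ A.mulVec x).re

/-- Positive kernels on `Ω × Ω`. -/
def IsPositiveKernel (Ω : Set ℍ[ℝ]) (K : ℍ[ℝ] → ℍ[ℝ] → ℍ[ℝ]) : Prop :=
  ∀ (r : ℕ) (q : Fin r → ℍ[ℝ]), (∀ i, q i ∈ Ω) →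
    IsPosSemidef (Matrix.of fun i j => K (q i) (q j))

/-- The kernel `K_S(p,q) = ∑ p ^ k (1 - S(p) conj(S(q))) conj(q) ^ k`. -/
def schurKernel (S : ℍ[ℝ] → ℍ[ℝ]) (p q : ℍ[ℝ]) : ℍ[ℝ] :=
  ∑' k : ℕ, p ^ k * (1 - S p * star (S q)) * star q ^ k

/-- The `(n + 1) × (n + 1)` lower triangular Toeplitz matrix of the coefficients
`a_0, …, a_n`. -/
def toeplitz (a : ℕ → ℍ[ℝ]) (n : ℕ) : Matrix (Fin (n + 1)) (Fin (n + 1)) ℍ[ℝ] :=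
  Matrix.of fun i j => if j ≤ i then a ((i : ℕ) - (j : ℕ)) else 0

end QuatHardy

end

noncomputable section

namespace QuatHardy

/-! ### Complex slices of the quaternions -/

/-! Statement 2 is the hub. For 1 → 2 the obstacle is that the variable p does not commute with the
coefficients, so `⋆` is not pointwise multiplication. The coefficients are therefore paired with a
central complex variable: W(z) = ∑ z^k ⊗ w_k = A(z) + iB(z) in ℂ ⊗ ℍ, with A = `rePart` and B =
`imPart`. There the Cauchy product is pointwise multiplication (`rePart_conv`, `imPart_conv`), and
the mean of |A|² + |B|² over the unit circle is ∑ |w_k|² (`integral_rePart_imPart`). Replacing i by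
an imaginary unit I recovers the values on a slice, so |S| ≤ 1 gives |α + Iβ| ≤ 1 for every I; this
makes left multiplication by α + iβ a contraction of ℂ ⊗ ℍ
(`norm_sq_mul_sub_add_norm_sq_mul_add_le`). The dilation p ↦ rp supplies absolute convergence, and r
→ 1 concludes.

2 ↔ 3 is the reproducing kernel argument in ℓ² with its real inner product. The vector `kernelVec 1
q c` represents f ↦ Re(c̄ f(q)), and the adjoint of M_S sends it to `kernelVec (star (S q)) q c`;
positivity of K_S says exactly that this assignment is contractive on sums (`isPositiveKernel_iff`).
Positivity at one point yields |S| ≤ 1, and S = S ⋆ 1 has an expansion, whence 2 → 1. For 2 ↔ 4, the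
Toeplitz matrices are truncations of M_S, and a matrix is contractive iff its adjoint is. -/

theorem mul_self_of_mem_imagSphere {I : ℍ[ℝ]} (hI : I ∈ imagSphere) : I * I = -1 := by
  have h1 : star I = -I := Quaternion.star_eq_neg.2 hI.1
  have h2 := Quaternion.self_mul_star I
  rw [h1, Quaternion.normSq_eq_norm_mul_self, hI.2] at h2
  simpa [neg_eq_iff_eq_neg] using h2

/-- The embedding `x + i y ↦ x + I y` of `ℂ` into the quaternions. -/
def sliceHom {I : ℍ[ℝ]} (hI : I ∈ imagSphere) : ℂ →ₐ[ℝ] ℍ[ℝ] :=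
  Complex.liftAux I (mul_self_of_mem_imagSphere hI)

theorem sliceHom_apply {I : ℍ[ℝ]} (hI : I ∈ imagSphere) (z : ℂ) :
    sliceHom hI z = (z.re : ℍ[ℝ]) + I * (z.im : ℍ[ℝ]) := by
  rw [sliceHom, Complex.liftAux_apply, Quaternion.mul_coe_eq_smul]
  rfl

theorem norm_sliceHom {I : ℍ[ℝ]} (hI : I ∈ imagSphere) (z : ℂ) : ‖sliceHom hI z‖ = ‖z‖ := by
  have h : Quaternion.normSq I = 1 := by
    rw [Quaternion.normSq_eq_norm_mul_self, hI.2, one_mul]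
  rw [Quaternion.normSq_def', hI.1] at h
  have h2 : ‖sliceHom hI z‖ ^ 2 = ‖z‖ ^ 2 := by
    rw [sq, ← Quaternion.normSq_eq_norm_mul_self, sliceHom_apply, Quaternion.normSq_def',
      ← Complex.normSq_eq_norm_sq, Complex.normSq_apply, Quaternion.mul_coe_eq_smul]
    simp [hI.1]
    linear_combination z.im ^ 2 * h
  exact (sq_eq_sq₀ (norm_nonneg _) (norm_nonneg _)).1 h2

theorem exists_sliceHom_eq (p : ℍ[ℝ]) :
    ∃ (I : ℍ[ℝ]) (hI : I ∈ imagSphere) (z : ℂ), sliceHom hI z = p := by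
  by_cases h : p.im = 0
  · have hI : (Complex.I : ℍ[ℝ]) ∈ imagSphere := by
      refine ⟨by simp, ?_⟩
      rw [← pow_eq_one_iff_of_nonneg (norm_nonneg _) two_ne_zero, sq,
        ← Quaternion.normSq_eq_norm_mul_self, Quaternion.normSq_def']
      simp
    refine ⟨_, hI, p.re, ?_⟩
    rw [sliceHom_apply]
    have hp := Quaternion.re_add_im p
    rw [h, add_zero] at hp
    simpa using hp
  · have h0 : ‖p.im‖ ≠ 0 := norm_ne_zero_iff.2 h
    have hI : ‖p.im‖⁻¹ • p.im ∈ imagSphere := by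
      refine ⟨by simp, ?_⟩
      rw [norm_smul, norm_inv, norm_norm, inv_mul_cancel₀ h0]
    refine ⟨_, hI, ⟨p.re, ‖p.im‖⟩, ?_⟩
    rw [sliceHom_apply, Quaternion.mul_coe_eq_smul, smul_smul, mul_inv_cancel₀ h0, one_smul,
      Quaternion.re_add_im]

/-- The quaternions as a complex normed space, `i` acting by left multiplication by `I`. -/
abbrev sliceNormedSpace {I : ℍ[ℝ]} (hI : I ∈ imagSphere) : NormedSpace ℂ ℍ[ℝ] :=
  { Module.compHom ℍ[ℝ] (sliceHom hI).toRingHom with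
    norm_smul_le := fun z q => by
      change ‖sliceHom hI z * q‖ ≤ _
      rw [norm_mul, norm_sliceHom] }

theorem continuous_sliceHom {I : ℍ[ℝ]} (hI : I ∈ imagSphere) : Continuous (sliceHom hI) :=
  AddMonoidHomClass.continuous_of_bound (sliceHom hI) 1 fun z => by
    rw [norm_sliceHom, one_mul]

/-! ### Power series on the unit ball -/

theorem mem_unitBall {p : ℍ[ℝ]} : p ∈ unitBall ↔ ‖p‖ < 1 := by simp [unitBall]

theorem HasExpansion.summable_norm {f : ℍ[ℝ] → ℍ[ℝ]} {a : ℕ → ℍ[ℝ]} (h : HasExpansion f a)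
    {r : ℝ} (h0 : 0 ≤ r) (h1 : r < 1) : Summable fun k => r ^ k * ‖a k‖ := by
  have h2 := (h (r : ℍ[ℝ]) (by simpa [mem_unitBall, abs_of_nonneg h0] using h1)).summable.norm
  simpa [abs_of_nonneg h0] using h2

theorem HasExpansion.summable_norm_pow_mul {f : ℍ[ℝ] → ℍ[ℝ]} {a : ℕ → ℍ[ℝ]}
    (h : HasExpansion f a) {p : ℍ[ℝ]} (hp : p ∈ unitBall) : Summable fun k => ‖p ^ k * a k‖ := by
  simpa using h.summable_norm (norm_nonneg p) (mem_unitBall.1 hp)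

theorem summable_pow_mul_of_summable_sq {a : ℕ → ℍ[ℝ]} (ha : Summable fun k => ‖a k‖ ^ 2)
    {p : ℍ[ℝ]} (hp : p ∈ unitBall) : Summable fun k => p ^ k * a k := by
  rw [mem_unitBall] at hp
  have h1 : Summable fun k => (‖p‖ ^ 2) ^ k :=
    summable_geometric_of_lt_one (by positivity) (by nlinarith [norm_nonneg p])
  refine Summable.of_norm_bounded (h1.add ha) fun k => ?_
  rw [norm_mul, norm_pow, ← pow_mul, mul_comm 2 k, pow_mul]
  nlinarith [sq_nonneg (‖p‖ ^ k - ‖a k‖), sq_nonneg (‖p‖ ^ k), sq_nonneg (‖a k‖)]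

theorem one_le_radius_of_norm_le {𝕜 E F : Type*} [NontriviallyNormedField 𝕜]
    [NormedAddCommGroup E] [NormedSpace 𝕜 E] [NormedAddCommGroup F] [NormedSpace 𝕜 F]
    (P : FormalMultilinearSeries 𝕜 E F) {c : ℕ → ℝ} (hP : ∀ k, ‖P k‖ ≤ c k)
    (hc : ∀ r : ℝ, 0 ≤ r → r < 1 → Summable fun k => r ^ k * c k) : 1 ≤ P.radius := by
  refine ENNReal.le_of_forall_nnreal_lt fun r hr => ?_
  have hr1 : (r : ℝ) < 1 := by exact_mod_cast hr
  refine P.le_radius_of_summable ((hc r r.2 hr1).of_nonneg_of_le (fun k => by positivity) ?_)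
  intro k
  rw [mul_comm]
  exact mul_le_mul_of_nonneg_left (hP k) (by positivity)

/-- The term p^k a_k is the diagonal of the real k-linear map (p₁, …, p_k) ↦ p₁⋯p_k a_k, of norm at
most |a_k|, so f is real analytic on the ball. -/
theorem HasExpansion.differentiableAt {f : ℍ[ℝ] → ℍ[ℝ]} {a : ℕ → ℍ[ℝ]} (h : HasExpansion f a)
    {p : ℍ[ℝ]} (hp : p ∈ unitBall) : DifferentiableAt ℝ f p := by
  let P : FormalMultilinearSeries ℝ ℍ[ℝ] ℍ[ℝ] := fun k =>
    ((ContinuousLinearMap.mul ℝ ℍ[ℝ]).flip (a k)).compContinuousMultilinearMap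
      (ContinuousMultilinearMap.mkPiAlgebraFin ℝ k ℍ[ℝ])
  have hP : ∀ k, ‖P k‖ ≤ ‖a k‖ := fun k => by
    refine ContinuousMultilinearMap.opNorm_le_bound (norm_nonneg _) fun m => ?_
    simp only [P, ContinuousLinearMap.compContinuousMultilinearMap_coe, Function.comp_apply,
      ContinuousMultilinearMap.mkPiAlgebraFin_apply, ContinuousLinearMap.flip_apply,
      ContinuousLinearMap.mul_apply', norm_mul]
    rw [mul_comm, List.norm_prod, List.map_ofFn, List.prod_ofFn]
    rfl
  have hf : HasFPowerSeriesOnBall f P 0 1 :=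
    { r_le := one_le_radius_of_norm_le P hP fun r h0 h1 => h.summable_norm h0 h1
      r_pos := one_pos
      hasSum := fun {y} hy => by
        have hy' : y ∈ unitBall := by
          rw [← ENNReal.ofReal_one, Metric.eball_ofReal] at hy
          exact hy
        simpa [P] using h y hy' }
  refine hf.differentiableOn.differentiableAt (Metric.isOpen_eball.mem_nhds ?_)
  rw [← ENNReal.ofReal_one, Metric.eball_ofReal]
  exact hp

/-- With i acting as left multiplication by I, the restriction to a slice is an ordinary ℍ-valued
complex power series. Its complex derivative d gives ∂f/∂x = d and ∂f/∂y = I d. -/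
theorem HasExpansion.sliceRegularOn {f : ℍ[ℝ] → ℍ[ℝ]} {a : ℕ → ℍ[ℝ]} (h : HasExpansion f a) :
    SliceRegularOn f unitBall := by
  refine ⟨fun p hp => h.differentiableAt hp, fun I hI x y hxy => ?_⟩
  let _ := sliceNormedSpace hI
  have : IsScalarTower ℝ ℂ ℍ[ℝ] := ⟨fun r z q => by
    change sliceHom hI (r • z) * q = r • (sliceHom hI z * q)
    rw [map_smul, smul_mul_assoc]⟩
  have smul_eq : ∀ (z : ℂ) (q : ℍ[ℝ]), z • q = sliceHom hI z * q := fun _ _ => rfl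
  let P : FormalMultilinearSeries ℂ ℂ ℍ[ℝ] := fun k =>
    ContinuousMultilinearMap.mkPiRing ℂ (Fin k) (a k)
  have hf : HasFPowerSeriesOnBall (fun z => f (sliceHom hI z)) P 0 1 :=
    { r_le := one_le_radius_of_norm_le P (c := fun k => ‖a k‖)
        (fun k => (ContinuousMultilinearMap.norm_mkPiRing _).le)
        fun r h0 h1 => h.summable_norm h0 h1
      r_pos := one_pos
      hasSum := fun {z} hz => by
        have hz' : sliceHom hI z ∈ unitBall := by
          rw [← ENNReal.ofReal_one, Metric.eball_ofReal, mem_ball_zero_iff] at hz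
          rwa [mem_unitBall, norm_sliceHom]
        simpa [P, smul_eq] using h _ hz' }
  have hz : (⟨x, y⟩ : ℂ) ∈ Metric.eball (0 : ℂ) 1 := by
    rw [← ENNReal.ofReal_one, Metric.eball_ofReal, mem_ball_zero_iff, ← norm_sliceHom hI,
      sliceHom_apply, ← mem_unitBall]
    exact hxy
  have hd := (hf.differentiableOn.differentiableAt (Metric.isOpen_eball.mem_nhds hz)).hasDerivAt
  set d := deriv (fun z => f (sliceHom hI z)) ⟨x, y⟩
  have hx : HasDerivAt (fun t : ℝ => (⟨t, y⟩ : ℂ)) 1 x := by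
    have := (Complex.ofRealCLM.hasDerivAt (x := x)).add_const (y * Complex.I)
    simpa [Complex.mk_eq_add_mul_I] using this
  have hy : HasDerivAt (fun t : ℝ => (⟨x, t⟩ : ℂ)) Complex.I y := by
    have := ((Complex.ofRealCLM.hasDerivAt (x := y)).mul_const Complex.I).const_add (x : ℂ)
    simpa [Complex.mk_eq_add_mul_I] using this
  have h1 := HasDerivAt.scomp (h := fun t : ℝ => (⟨t, y⟩ : ℂ)) x hd hx
  have h2 := HasDerivAt.scomp (h := fun t : ℝ => (⟨x, t⟩ : ℂ)) y hd hy
  simp only [Function.comp_def, sliceHom_apply, smul_eq] at h1 h2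
  rw [h1.deriv, h2.deriv]
  simp [← mul_assoc, mul_self_of_mem_imagSphere hI]

/-- The slice equation is the Cauchy–Riemann equation for the complex structure of left
multiplication by I, so Taylor's theorem for holomorphic functions applies on each slice. -/
theorem SliceRegularOn.hasSum_slice {f : ℍ[ℝ] → ℍ[ℝ]} (hf : SliceRegularOn f unitBall)
    {I : ℍ[ℝ]} (hI : I ∈ imagSphere) :
    ∃ a : ℕ → ℍ[ℝ], ∀ z : ℂ, ‖z‖ < 1 →
      HasSum (fun k => sliceHom hI z ^ k * a k) (f (sliceHom hI z)) := by
  let _ := sliceNormedSpace hI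
  have : IsScalarTower ℝ ℂ ℍ[ℝ] := ⟨fun r z q => by
    change sliceHom hI (r • z) * q = r • (sliceHom hI z * q)
    rw [map_smul, smul_mul_assoc]⟩
  have smul_eq : ∀ (z : ℂ) (q : ℍ[ℝ]), z • q = sliceHom hI z * q := fun _ _ => rfl
  have hd : DifferentiableOn ℂ (fun z => f (sliceHom hI z)) (Metric.ball 0 1) := by
    intro z hz
    have hz' : sliceHom hI z ∈ unitBall := by
      rw [mem_ball_zero_iff] at hz
      rwa [mem_unitBall, norm_sliceHom]
    let Φ : ℂ →L[ℝ] ℍ[ℝ] := ⟨(sliceHom hI).toLinearMap, continuous_sliceHom hI⟩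
    have h1 : HasFDerivAt (fun z => f (sliceHom hI z))
        ((fderiv ℝ f (sliceHom hI z)).comp Φ) z :=
      HasFDerivAt.comp z (hf.1 _ hz').hasFDerivAt Φ.hasFDerivAt
    set L := (fderiv ℝ f (sliceHom hI z)).comp Φ
    have hx : HasDerivAt (fun t : ℝ => (⟨t, z.im⟩ : ℂ)) 1 z.re := by
      have := (Complex.ofRealCLM.hasDerivAt (x := z.re)).add_const (z.im * Complex.I)
      simpa [Complex.mk_eq_add_mul_I] using this
    have hy : HasDerivAt (fun t : ℝ => (⟨z.re, t⟩ : ℂ)) Complex.I z.im := by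
      have := ((Complex.ofRealCLM.hasDerivAt (x := z.im)).mul_const Complex.I).const_add (z.re : ℂ)
      simpa [Complex.mk_eq_add_mul_I] using this
    have e1 := HasFDerivAt.comp_hasDerivAt (f := fun t : ℝ => (⟨t, z.im⟩ : ℂ)) z.re h1 hx
    have e2 := HasFDerivAt.comp_hasDerivAt (f := fun t : ℝ => (⟨z.re, t⟩ : ℂ)) z.im h1 hy
    have cr := hf.2 I hI z.re z.im (by rwa [← sliceHom_apply])
    simp only [Function.comp_def, sliceHom_apply] at e1 e2
    rw [e1.deriv, e2.deriv] at cr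
    -- `cr` reads L 1 + I (L i) = 0; left multiplication by I turns it into ℂ-linearity of L.
    have hLI : L Complex.I = I * L 1 := by
      have h3 := congrArg (fun q => I * q) cr
      simp only [mul_add, ← mul_assoc, mul_self_of_mem_imagSphere hI, mul_zero, neg_mul,
        one_mul] at h3
      exact (add_neg_eq_zero.1 h3).symm
    let L' : ℂ →L[ℂ] ℍ[ℝ] := ContinuousLinearMap.toSpanSingleton ℂ (L 1)
    have hL' : L'.restrictScalars ℝ = L := by
      refine ContinuousLinearMap.ext fun w => ?_
      have hw : w = w.re • (1 : ℂ) + w.im • Complex.I := by simp [Complex.re_add_im]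
      change w • L 1 = L w
      rw [smul_eq, sliceHom_apply]
      conv_rhs => rw [hw, map_add, map_smul, map_smul, hLI]
      rw [add_mul, Quaternion.coe_mul_eq_smul, Quaternion.mul_coe_eq_smul, smul_mul_assoc]
    exact (hasFDerivAt_of_restrictScalars ℝ h1 hL').differentiableAt.differentiableWithinAt
  refine ⟨fun k => (k.factorial : ℂ)⁻¹ • iteratedDeriv k (fun z => f (sliceHom hI z)) 0,
    fun z hz => ?_⟩
  have h := Complex.hasSum_taylorSeries_on_ball hd (z := z) (by simpa using hz)
  have e : ∀ k, sliceHom hI z ^ k * ((k.factorial : ℂ)⁻¹ •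
      iteratedDeriv k (fun z => f (sliceHom hI z)) 0) = (k.factorial : ℂ)⁻¹ • (z - 0) ^ k •
      iteratedDeriv k (fun z => f (sliceHom hI z)) 0 := fun k => by
    rw [← map_pow, ← smul_eq, smul_comm, sub_zero]
  simp only [e]
  exact h

theorem eq_of_hasSum_real {f : ℝ → ℍ[ℝ]} {a b : ℕ → ℍ[ℝ]}
    (ha : ∀ t : ℝ, |t| < 1 → HasSum (fun k => (t : ℍ[ℝ]) ^ k * a k) (f t))
    (hb : ∀ t : ℝ, |t| < 1 → HasSum (fun k => (t : ℍ[ℝ]) ^ k * b k) (f t)) : a = b := by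
  have key : ∀ c : ℕ → ℍ[ℝ],
      (∀ t : ℝ, |t| < 1 → HasSum (fun k => (t : ℍ[ℝ]) ^ k * c k) (f t)) →
      HasFPowerSeriesAt f (fun k => ContinuousMultilinearMap.mkPiRing ℝ (Fin k) (c k) :
        FormalMultilinearSeries ℝ ℝ ℍ[ℝ]) 0 := by
    intro c hc
    refine hasFPowerSeriesAt_iff.2 ?_
    filter_upwards [Metric.ball_mem_nhds (0 : ℝ) one_pos] with t ht
    have h2 := hc t (by simpa using ht)
    simp only [← Quaternion.coe_pow, Quaternion.coe_mul_eq_smul] at h2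
    simpa [FormalMultilinearSeries.coeff] using h2
  have h := (key a ha).eq_formalMultilinearSeries (key b hb)
  funext k
  simpa [FormalMultilinearSeries.coeff] using
    congrArg (fun p : FormalMultilinearSeries ℝ ℝ ℍ[ℝ] => p.coeff k) h

/-- All slices share the real interval (-1, 1), which already determines the coefficients; so the
expansions on different slices agree. -/
theorem SliceRegularOn.exists_hasExpansion {f : ℍ[ℝ] → ℍ[ℝ]} (hf : SliceRegularOn f unitBall) :
    ∃ a, HasExpansion f a := by
  have hreal : ∀ {I : ℍ[ℝ]} (hI : I ∈ imagSphere) {a : ℕ → ℍ[ℝ]},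
      (∀ z : ℂ, ‖z‖ < 1 → HasSum (fun k => sliceHom hI z ^ k * a k) (f (sliceHom hI z))) →
      ∀ t : ℝ, |t| < 1 → HasSum (fun k => (t : ℍ[ℝ]) ^ k * a k) (f t) := by
    intro I hI a ha t ht
    simpa [sliceHom_apply] using ha t (by simpa using ht)
  obtain ⟨I₀, hI₀, -⟩ := exists_sliceHom_eq 0
  obtain ⟨a, ha⟩ := hf.hasSum_slice hI₀
  refine ⟨a, fun p hp => ?_⟩
  obtain ⟨I, hI, z, rfl⟩ := exists_sliceHom_eq p
  obtain ⟨b, hb⟩ := hf.hasSum_slice hI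
  rw [eq_of_hasSum_real (hreal hI₀ ha) (hreal hI hb)]
  exact hb z (by rwa [mem_unitBall, norm_sliceHom] at hp)

/-! ### The Cauchy product -/

/-- The Cauchy product of two sequences. -/
def conv (s a : ℕ → ℍ[ℝ]) (n : ℕ) : ℍ[ℝ] :=
  ∑ kl ∈ Finset.HasAntidiagonal.antidiagonal n, s kl.1 * a kl.2

/-- Only powers of p are moved past each other: p^k S(p) a_k = ∑ p^(j+k) s_j a_k, and the absolutely
convergent double series is regrouped along j + k = n. -/
theorem HasExpansion.hasSum_conv {S f : ℍ[ℝ] → ℍ[ℝ]} {s a : ℕ → ℍ[ℝ]} (hS : HasExpansion S s)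
    (hf : HasExpansion f a) {p : ℍ[ℝ]} (hp : p ∈ unitBall) :
    HasSum (fun n => p ^ n * conv s a n) (∑' k, p ^ k * S p * a k) := by
  let F : ℕ × ℕ → ℍ[ℝ] := fun x => p ^ (x.1 + x.2) * (s x.1 * a x.2)
  have hF : Summable F := by
    refine Summable.of_norm_bounded
      ((hS.summable_norm_pow_mul hp).mul_of_nonneg (hf.summable_norm_pow_mul hp)
        (fun _ => norm_nonneg _) fun _ => norm_nonneg _) fun x => le_of_eq ?_
    simp only [F, norm_mul, norm_pow, pow_add]
    ring
  have h1 : ∑' k, p ^ k * S p * a k = ∑' x, F x := by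
    rw [← (Equiv.prodComm ℕ ℕ).tsum_eq F]
    have hF' : Summable fun x => F (Equiv.prodComm ℕ ℕ x) :=
      (Equiv.prodComm ℕ ℕ).summable_iff.2 hF
    rw [hF'.tsum_prod]
    refine tsum_congr fun k => ?_
    rw [← (((hS p hp).mul_left (p ^ k)).mul_right (a k)).tsum_eq]
    refine tsum_congr fun j => ?_
    change _ = p ^ (j + k) * (s j * a k)
    rw [add_comm, pow_add]
    simp only [mul_assoc]
  rw [h1, ← Finset.HasAntidiagonal.sigmaAntidiagonalEquivProd.tsum_eq F]
  have h2 := (Finset.HasAntidiagonal.sigmaAntidiagonalEquivProd.summable_iff.2 hF).hasSum.sigma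
    fun n => hasSum_fintype _
  convert h2 using 2 with n
  swap
  · rfl
  rw [conv, Finset.mul_sum, Finset.univ_eq_attach, ← Finset.sum_attach]
  refine Finset.sum_congr rfl fun x _ => ?_
  have := Finset.HasAntidiagonal.mem_antidiagonal.1 x.2
  simp [F, this]

theorem HasExpansion.starMul {S f : ℍ[ℝ] → ℍ[ℝ]} {s a : ℕ → ℍ[ℝ]} (hS : HasExpansion S s)
    (hf : HasExpansion f a) : HasExpansion (starMul S f) (conv s a) := fun p hp => by
  rw [QuatHardy.starMul, hf.coeff_eq]
  exact hS.hasSum_conv hf hp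

theorem hasExpansion_of_summable_sq {a : ℕ → ℍ[ℝ]} (ha : Summable fun k => ‖a k‖ ^ 2) :
    HasExpansion (fun p => ∑' k, p ^ k * a k) a := fun _ hp =>
  (summable_pow_mul_of_summable_sq ha hp).hasSum

/-! ### Parseval's identity on the circle -/

theorem norm_sq_of_orthonormal_hasSum {ι E : Type*} [NormedAddCommGroup E]
    [InnerProductSpace ℂ E] {e : ι → E} (he : Orthonormal ℂ e) {c : ι → ℂ} {x : E}
    (h : HasSum (fun i => c i • e i) x) : HasSum (fun i => ‖c i‖ ^ 2) (‖x‖ ^ 2) := by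
  have h2 : Filter.Tendsto (fun s : Finset ι => ‖∑ i ∈ s, c i • e i‖ ^ 2) Filter.atTop
      (𝓝 (‖x‖ ^ 2)) := (Filter.Tendsto.norm h).pow 2
  refine h2.congr fun s => ?_
  have h3 := he.inner_sum c c s
  rw [inner_self_eq_norm_sq_to_K] at h3
  have h4 : ((‖∑ i ∈ s, c i • e i‖ ^ 2 : ℝ) : ℂ) = ((∑ i ∈ s, ‖c i‖ ^ 2 : ℝ) : ℂ) := by
    push_cast
    simpa [RCLike.conj_mul] using h3
  exact_mod_cast h4

/-- The point `e ^ (2 π i t)` of the unit circle. -/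
def circlePt (t : AddCircle (1 : ℝ)) : ℂ := fourier 1 t

theorem continuous_circlePt : Continuous circlePt := (fourier 1).continuous

theorem norm_circlePt (t : AddCircle (1 : ℝ)) : ‖circlePt t‖ = 1 := by
  simp only [circlePt, fourier_one, Circle.norm_coe]

theorem fourier_natCast (k : ℕ) (t : AddCircle (1 : ℝ)) : fourier (k : ℤ) t = circlePt t ^ k := by
  induction k with
  | zero => simp
  | succ k ih => rw [Nat.cast_succ, fourier_add, ih, pow_succ, circlePt]

open MeasureTheory AddCircle in
-- The series converges uniformly, so its sum in L² is an expansion in the orthonormal Fourier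
-- basis.
theorem integral_norm_sq_tsum {c : ℕ → ℂ} (hc : Summable fun k => ‖c k‖) :
    ∫ t, ‖∑' k, circlePt t ^ k * c k‖ ^ 2 ∂haarAddCircle = ∑' k, ‖c k‖ ^ 2 := by
  let u : ℕ → C(AddCircle (1 : ℝ), ℂ) := fun k => c k • fourier (k : ℤ)
  have hu : Summable u := Summable.of_norm <| hc.congr fun k => by
    rw [norm_smul, fourier_norm, mul_one]
  have hval : ∀ t, (∑' k, u k) t = ∑' k, circlePt t ^ k * c k := fun t => by
    rw [← ContinuousMap.tsum_apply hu]
    refine tsum_congr fun k => ?_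
    change c k * fourier (k : ℤ) t = _
    rw [fourier_natCast, mul_comm]
  have h1 : HasSum (fun k : ℕ => c k • fourierLp (T := 1) 2 (k : ℤ))
      (ContinuousMap.toLp 2 haarAddCircle ℂ (∑' k, u k)) := by
    have := hu.hasSum.mapL (ContinuousMap.toLp (E := ℂ) 2 (haarAddCircle (T := (1 : ℝ))) ℂ)
    simpa [u, fourierLp] using this
  have h2 := norm_sq_of_orthonormal_hasSum
    (orthonormal_fourier.comp _ (Nat.cast_injective (R := ℤ))) h1
  rw [h2.tsum_eq]
  have h3 := congrArg Complex.re (ContinuousMap.inner_toLp (𝕜 := ℂ)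
    (haarAddCircle (T := (1 : ℝ))) (∑' k, u k) (∑' k, u k))
  rw [inner_self_eq_norm_sq_to_K] at h3
  have h4 : ∀ t, (∑' k, u k) t * (starRingEnd ℂ) ((∑' k, u k) t)
      = ((‖∑' k, circlePt t ^ k * c k‖ ^ 2 : ℝ) : ℂ) := fun t => by
    rw [hval, Complex.mul_conj, Complex.normSq_eq_norm_sq]
  simp only [h4, integral_complex_ofReal] at h3
  rw [Complex.ofReal_re] at h3
  rw [← h3]
  norm_cast

/-! ### Real and imaginary parts of a quaternionic power series with complex argument -/

/-- `∑ Re(z ^ k) w_k`. -/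
def rePart (w : ℕ → ℍ[ℝ]) (z : ℂ) : ℍ[ℝ] := ∑' k, (z ^ k).re • w k

/-- `∑ Im(z ^ k) w_k`. -/
def imPart (w : ℕ → ℍ[ℝ]) (z : ℂ) : ℍ[ℝ] := ∑' k, (z ^ k).im • w k

section

variable {w v : ℕ → ℍ[ℝ]} {z : ℂ}

theorem norm_re_pow_smul_le (hz : ‖z‖ ≤ 1) (k : ℕ) (q : ℍ[ℝ]) : ‖(z ^ k).re • q‖ ≤ ‖q‖ := by
  rw [norm_smul]
  refine mul_le_of_le_one_left (norm_nonneg _) ((Complex.abs_re_le_norm _).trans ?_)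
  rw [norm_pow]
  exact pow_le_one₀ (norm_nonneg _) hz

theorem norm_im_pow_smul_le (hz : ‖z‖ ≤ 1) (k : ℕ) (q : ℍ[ℝ]) : ‖(z ^ k).im • q‖ ≤ ‖q‖ := by
  rw [norm_smul]
  refine mul_le_of_le_one_left (norm_nonneg _) ((Complex.abs_im_le_norm _).trans ?_)
  rw [norm_pow]
  exact pow_le_one₀ (norm_nonneg _) hz

theorem summable_norm_re_pow_smul (hw : Summable fun k => ‖w k‖) (hz : ‖z‖ ≤ 1) :
    Summable fun k => ‖(z ^ k).re • w k‖ :=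
  hw.of_nonneg_of_le (fun _ => norm_nonneg _) fun k => norm_re_pow_smul_le hz k _

theorem summable_norm_im_pow_smul (hw : Summable fun k => ‖w k‖) (hz : ‖z‖ ≤ 1) :
    Summable fun k => ‖(z ^ k).im • w k‖ :=
  hw.of_nonneg_of_le (fun _ => norm_nonneg _) fun k => norm_im_pow_smul_le hz k _

theorem continuous_rePart (hw : Summable fun k => ‖w k‖) :
    Continuous fun t => rePart w (circlePt t) :=
  continuous_tsum (fun k => (Complex.continuous_re.comp (continuous_circlePt.pow k)).smul
    continuous_const) hw fun k t => norm_re_pow_smul_le (norm_circlePt t).le k _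

theorem continuous_imPart (hw : Summable fun k => ‖w k‖) :
    Continuous fun t => imPart w (circlePt t) :=
  continuous_tsum (fun k => (Complex.continuous_im.comp (continuous_circlePt.pow k)).smul
    continuous_const) hw fun k t => norm_im_pow_smul_le (norm_circlePt t).le k _

theorem summable_norm_conv (hw : Summable fun k => ‖w k‖) (hv : Summable fun k => ‖v k‖) :
    Summable fun k => ‖conv w v k‖ :=
  summable_norm_sum_mul_antidiagonal_of_summable_norm hw hv

/-- Together with `imPart_conv`, this is multiplicativity of w ↦ ∑ z^k ⊗ w_k in ℂ ⊗ ℍ, where z is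
central. -/
theorem rePart_conv (hw : Summable fun k => ‖w k‖) (hv : Summable fun k => ‖v k‖)
    (hz : ‖z‖ ≤ 1) :
    rePart (conv w v) z = rePart w z * rePart v z - imPart w z * imPart v z := by
  have wr := summable_norm_re_pow_smul hw hz
  have wi := summable_norm_im_pow_smul hw hz
  have vr := summable_norm_re_pow_smul hv hz
  have vi := summable_norm_im_pow_smul hv hz
  simp only [rePart, imPart]
  rw [tsum_mul_tsum_eq_tsum_sum_antidiagonal_of_summable_norm wr vr,
    tsum_mul_tsum_eq_tsum_sum_antidiagonal_of_summable_norm wi vi,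
    ← (summable_norm_sum_mul_antidiagonal_of_summable_norm wr vr).of_norm.tsum_sub
      (summable_norm_sum_mul_antidiagonal_of_summable_norm wi vi).of_norm]
  refine tsum_congr fun n => ?_
  rw [conv, Finset.smul_sum, ← Finset.sum_sub_distrib]
  refine Finset.sum_congr rfl fun x hx => ?_
  rw [← Finset.HasAntidiagonal.mem_antidiagonal.1 hx, pow_add, Complex.mul_re, smul_mul_smul_comm,
    smul_mul_smul_comm, sub_smul]

theorem imPart_conv (hw : Summable fun k => ‖w k‖) (hv : Summable fun k => ‖v k‖)
    (hz : ‖z‖ ≤ 1) :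
    imPart (conv w v) z = rePart w z * imPart v z + imPart w z * rePart v z := by
  have wr := summable_norm_re_pow_smul hw hz
  have wi := summable_norm_im_pow_smul hw hz
  have vr := summable_norm_re_pow_smul hv hz
  have vi := summable_norm_im_pow_smul hv hz
  simp only [rePart, imPart]
  rw [tsum_mul_tsum_eq_tsum_sum_antidiagonal_of_summable_norm wr vi,
    tsum_mul_tsum_eq_tsum_sum_antidiagonal_of_summable_norm wi vr,
    ← (summable_norm_sum_mul_antidiagonal_of_summable_norm wr vi).of_norm.tsum_add
      (summable_norm_sum_mul_antidiagonal_of_summable_norm wi vr).of_norm]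
  refine tsum_congr fun n => ?_
  rw [conv, Finset.smul_sum, ← Finset.sum_add_distrib]
  refine Finset.sum_congr rfl fun x hx => ?_
  rw [← Finset.HasAntidiagonal.mem_antidiagonal.1 hx, pow_add, Complex.mul_im, smul_mul_smul_comm,
    smul_mul_smul_comm, add_smul]

/-- For a coordinate `φ` of the quaternions, the pair `φ (rePart w z)`, `φ (imPart w z)` consists of
the real and imaginary part of a complex power series. -/
theorem norm_sq_tsum_coord (φ : ℍ[ℝ] →L[ℝ] ℝ) (hw : Summable fun k => ‖w k‖) (hz : ‖z‖ ≤ 1) :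
    ‖∑' k, z ^ k * (φ (w k) : ℂ)‖ ^ 2 = φ (rePart w z) ^ 2 + φ (imPart w z) ^ 2 := by
  have wr := (summable_norm_re_pow_smul hw hz).of_norm
  have wi := (summable_norm_im_pow_smul hw hz).of_norm
  have hs : Summable fun k => z ^ k * (φ (w k) : ℂ) := by
    refine Summable.of_norm_bounded (hw.mul_left ‖φ‖) fun k => ?_
    rw [norm_mul, norm_pow, Complex.norm_real]
    exact (mul_le_of_le_one_left (norm_nonneg _) (pow_le_one₀ (norm_nonneg _) hz)).trans
      (φ.le_opNorm _)
  rw [← Complex.normSq_eq_norm_sq, Complex.normSq_apply, Complex.re_tsum hs, Complex.im_tsum hs,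
    rePart, imPart, φ.map_tsum wr, φ.map_tsum wi]
  simp [sq]

end

/-- The four coordinates of the quaternions. -/
def coord (i : Fin 4) : ℍ[ℝ] →L[ℝ] ℝ :=
  (EuclideanSpace.proj i : EuclideanSpace ℝ (Fin 4) →L[ℝ] ℝ).comp
    Quaternion.linearIsometryEquivTuple.toContinuousLinearEquiv.toContinuousLinearMap

theorem sum_coord_sq (q : ℍ[ℝ]) : ∑ i, coord i q ^ 2 = ‖q‖ ^ 2 := by
  rw [← Quaternion.linearIsometryEquivTuple.norm_map q, EuclideanSpace.norm_sq_eq]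
  simp [coord]

open MeasureTheory AddCircle in
-- Parseval's identity is applied to each of the four real coordinates and the results are added.
theorem integral_rePart_imPart {w : ℕ → ℍ[ℝ]} (hw : Summable fun k => ‖w k‖) :
    ∫ t, (‖rePart w (circlePt t)‖ ^ 2 + ‖imPart w (circlePt t)‖ ^ 2) ∂haarAddCircle =
      ∑' k, ‖w k‖ ^ 2 := by
  have hφ : ∀ i, Summable fun k => ‖((coord i (w k) : ℝ) : ℂ)‖ := fun i => by
    refine (hw.mul_left ‖coord i‖).of_nonneg_of_le (fun _ => norm_nonneg _) fun k => ?_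
    rw [Complex.norm_real]
    exact (coord i).le_opNorm _
  have h1 : ∀ t, ‖rePart w (circlePt t)‖ ^ 2 + ‖imPart w (circlePt t)‖ ^ 2 =
      ∑ i, ‖∑' k, circlePt t ^ k * (coord i (w k) : ℂ)‖ ^ 2 := fun t => by
    simp only [norm_sq_tsum_coord _ hw (norm_circlePt t).le, Finset.sum_add_distrib, sum_coord_sq]
  have hsq : ∀ i, Summable fun k => ‖((coord i (w k) : ℝ) : ℂ)‖ ^ 2 := fun i =>
    ((hφ i).mul_norm (hφ i)).comp_injective (i := fun k => (k, k)) (fun _ _ h => (Prod.ext_iff.1 h).1)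
      |>.congr fun k => by simp [sq]
  simp only [h1]
  rw [integral_finsetSum]
  · simp only [integral_norm_sq_tsum (hφ _)]
    rw [← Summable.tsum_finsetSum fun i _ => hsq i]
    refine tsum_congr fun k => ?_
    rw [← sum_coord_sq]
    simp
  · intro i _
    refine Continuous.integrable_of_hasCompactSupport ?_ (HasCompactSupport.of_compactSpace _)
    simp only [norm_sq_tsum_coord _ hw (norm_circlePt _).le]
    exact (((coord i).continuous.comp (continuous_rePart hw)).pow 2).add
      (((coord i).continuous.comp (continuous_imPart hw)).pow 2)

/-! ### Schur functions are contractive multipliers -/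

theorem norm_im_sq (q : ℍ[ℝ]) : ‖q.im‖ ^ 2 = ‖q‖ ^ 2 - q.re ^ 2 := by
  simp only [sq, ← Quaternion.normSq_eq_norm_mul_self, Quaternion.normSq_def']
  simp
  ring

theorem abs_re_le_norm (q : ℍ[ℝ]) : |q.re| ≤ ‖q‖ := by
  refine abs_le_of_sq_le_sq ?_ (norm_nonneg _)
  nlinarith [norm_im_sq q, sq_nonneg ‖q.im‖]

theorem norm_im_le_norm (q : ℍ[ℝ]) : ‖q.im‖ ≤ ‖q‖ := by
  refine le_of_sq_le_sq ?_ (norm_nonneg _)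
  nlinarith [norm_im_sq q, sq_nonneg q.re]

/-- Since |α + Iβ|² = |α|² + |β|² + 2 Re(Im(αβ̄) Ī), the best bound comes from taking I in the
direction of Im(αβ̄). -/
theorem norm_sq_add_norm_im_le {α β : ℍ[ℝ]} (h : ∀ I ∈ imagSphere, ‖α + I * β‖ ≤ 1) :
    ‖α‖ ^ 2 + ‖β‖ ^ 2 + 2 * ‖(α * star β).im‖ ≤ 1 := by
  have key : ∀ I ∈ imagSphere,
      ‖α‖ ^ 2 + ‖β‖ ^ 2 + 2 * ((α * star β).im * star I).re ≤ 1 := fun I hI => by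
    have h1 : ‖α + I * β‖ ^ 2 = ‖α‖ ^ 2 + ‖I‖ ^ 2 * ‖β‖ ^ 2 +
        2 * ((α * star β).im * star I).re := by
      simp only [sq, ← Quaternion.normSq_eq_norm_mul_self, Quaternion.normSq_def']
      simp [hI.1]
      ring
    have h2 := pow_le_one₀ (n := 2) (norm_nonneg _) (h I hI)
    rw [h1, hI.2] at h2
    linarith
  by_cases h0 : (α * star β).im = 0
  · obtain ⟨I, hI, -⟩ := exists_sliceHom_eq 0
    simpa [h0] using key I hI
  · have h1 : ‖(α * star β).im‖ ≠ 0 := norm_ne_zero_iff.2 h0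
    have hI : ‖(α * star β).im‖⁻¹ • (α * star β).im ∈ imagSphere := by
      refine ⟨by simp, ?_⟩
      rw [norm_smul, norm_inv, norm_norm, inv_mul_cancel₀ h1]
    have h2 := key _ hI
    rw [Quaternion.star_smul, mul_smul_comm, Quaternion.self_mul_star, Quaternion.normSq_eq_norm_mul_self,
      Quaternion.re_smul, Quaternion.re_coe, smul_eq_mul,
      inv_mul_cancel_left₀ h1] at h2
    exact h2

/-- Expanding (α + iβ)(a + ib) leaves the cross term 4 Re(Im(β̄α) Im(bā)), at most 4m|a||b| ≤
2m(|a|² + |b|²) with m = |Im(αβ̄)|. The preceding lemma has exactly this 2m to spare. -/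
theorem norm_sq_mul_sub_add_norm_sq_mul_add_le {α β : ℍ[ℝ]}
    (h : ∀ I ∈ imagSphere, ‖α + I * β‖ ≤ 1) (a b : ℍ[ℝ]) :
    ‖α * a - β * b‖ ^ 2 + ‖α * b + β * a‖ ^ 2 ≤ ‖a‖ ^ 2 + ‖b‖ ^ 2 := by
  have h1 := norm_sq_add_norm_im_le h
  have h2 : ‖α * a - β * b‖ ^ 2 + ‖α * b + β * a‖ ^ 2 =
      (‖α‖ ^ 2 + ‖β‖ ^ 2) * (‖a‖ ^ 2 + ‖b‖ ^ 2) +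
        4 * ((star β * α).im * (b * star a).im).re := by
    simp only [sq, ← Quaternion.normSq_eq_norm_mul_self, Quaternion.normSq_def']
    simp
    ring
  -- The products β̄α and αβ̄ have the same norm and the same real part.
  have h3 : ‖(star β * α).im‖ = ‖(α * star β).im‖ := by
    rw [← sq_eq_sq₀ (norm_nonneg _) (norm_nonneg _), norm_im_sq, norm_im_sq, norm_mul, norm_mul,
      mul_comm ‖star β‖]
    congr 2
    simp
    ring
  have h4 : ((star β * α).im * (b * star a).im).re ≤ ‖(α * star β).im‖ * (‖b‖ * ‖a‖) := by
    refine (le_abs_self _).trans ((abs_re_le_norm _).trans ?_)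
    rw [norm_mul, h3]
    refine mul_le_mul_of_nonneg_left ((norm_im_le_norm _).trans ?_) (norm_nonneg _)
    rw [norm_mul, Quaternion.norm_star]
  rw [h2]
  have h5 := mul_le_mul_of_nonneg_right h1 (by positivity : 0 ≤ ‖a‖ ^ 2 + ‖b‖ ^ 2)
  have h6 := mul_nonneg (norm_nonneg (α * star β).im) (sq_nonneg (‖a‖ - ‖b‖))
  nlinarith

/-- The substitution i ↦ I leads from ℂ ⊗ ℍ back to the values on the slice of I. -/
theorem rePart_add_mul_imPart {w : ℕ → ℍ[ℝ]} (hw : Summable fun k => ‖w k‖) {z : ℂ}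
    (hz : ‖z‖ ≤ 1) {I : ℍ[ℝ]} (hI : I ∈ imagSphere) :
    rePart w z + I * imPart w z = ∑' k, sliceHom hI z ^ k * w k := by
  have wr := (summable_norm_re_pow_smul hw hz).of_norm
  have wi := (summable_norm_im_pow_smul hw hz).of_norm
  rw [rePart, imPart, ← wi.tsum_mul_left, ← wr.tsum_add (wi.mul_left I)]
  refine tsum_congr fun k => ?_
  rw [← map_pow, sliceHom_apply, add_mul, Quaternion.coe_mul_eq_smul, mul_assoc,
    Quaternion.coe_mul_eq_smul]

theorem conv_smul_pow (r : ℝ) (s a : ℕ → ℍ[ℝ]) :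
    conv (fun k => r ^ k • s k) (fun k => r ^ k • a k) = fun n => r ^ n • conv s a n := by
  funext n
  rw [conv, conv, Finset.smul_sum]
  refine Finset.sum_congr rfl fun x hx => ?_
  rw [← Finset.HasAntidiagonal.mem_antidiagonal.1 hx, pow_add, smul_mul_smul_comm]

theorem summable_sq_of_summable_norm {w : ℕ → ℍ[ℝ]} (hw : Summable fun k => ‖w k‖) :
    Summable fun k => ‖w k‖ ^ 2 := by
  have := (hw.mul_of_nonneg hw (fun _ => norm_nonneg _) fun _ => norm_nonneg _).comp_injective
    (i := fun k : ℕ => (k, k)) fun _ _ h => (Prod.ext_iff.1 h).1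
  exact this.congr fun k => (sq _).symm

open MeasureTheory AddCircle in
theorem HasExpansion.tsum_conv_sq_le {S : ℍ[ℝ] → ℍ[ℝ]} {s a : ℕ → ℍ[ℝ]} (hS : HasExpansion S s)
    (hb : ∀ p ∈ unitBall, ‖S p‖ ≤ 1) (ha : Summable fun k => ‖a k‖ ^ 2) {r : ℝ} (h0 : 0 ≤ r)
    (h1 : r < 1) :
    Summable (fun n => ‖r ^ n • conv s a n‖ ^ 2) ∧
      ∑' n, ‖r ^ n • conv s a n‖ ^ 2 ≤ ∑' n, ‖r ^ n • a n‖ ^ 2 := by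
  have hw : Summable fun k => ‖r ^ k • s k‖ := by
    simpa [norm_smul, abs_of_nonneg h0] using hS.summable_norm h0 h1
  have hv : Summable fun k => ‖r ^ k • a k‖ := by
    simpa [norm_smul, abs_of_nonneg h0] using
      (hasExpansion_of_summable_sq ha).summable_norm h0 h1
  have hwv := summable_norm_conv hw hv
  have hc := conv_smul_pow r s a
  have hint : ∀ u : ℕ → ℍ[ℝ], Summable (fun k => ‖u k‖) →
      Integrable (fun t => ‖rePart u (circlePt t)‖ ^ 2 + ‖imPart u (circlePt t)‖ ^ 2)
        (haarAddCircle (T := (1 : ℝ))) := fun u hu =>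
    Continuous.integrable_of_hasCompactSupport
      (((continuous_rePart hu).norm.pow 2).add ((continuous_imPart hu).norm.pow 2))
      (HasCompactSupport.of_compactSpace _)
  have main : ∑' n, ‖conv (fun k => r ^ k • s k) (fun k => r ^ k • a k) n‖ ^ 2 ≤
      ∑' n, ‖r ^ n • a n‖ ^ 2 := by
    rw [← integral_rePart_imPart hwv, ← integral_rePart_imPart hv]
    refine integral_mono (hint _ hwv) (hint _ hv) fun t => ?_
    have ht := (norm_circlePt t).le
    simp only [rePart_conv hw hv ht, imPart_conv hw hv ht]
    refine norm_sq_mul_sub_add_norm_sq_mul_add_le (fun I hI => ?_) _ _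
    rw [rePart_add_mul_imPart hw ht]
    -- Here α + Iβ is the value of S at the dilated point r(x + Iy), where z = x + iy lies on the
    -- circle.
    have hp : r • sliceHom hI (circlePt t) ∈ unitBall := by
      rw [mem_unitBall, norm_smul, norm_sliceHom, norm_circlePt, mul_one, Real.norm_eq_abs,
        abs_of_nonneg h0]
      exact h1
    convert hb _ hp using 2
    rw [← (hS _ hp).tsum_eq]
    refine tsum_congr fun k => ?_
    rw [smul_pow, smul_mul_assoc, mul_smul_comm]
  rw [hc] at main hwv
  exact ⟨summable_sq_of_summable_norm hwv, main⟩

/-- If the Cauchy product with the coefficients of `S` is contractive on square summable sequences,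
then `S` is a contractive multiplier. -/
theorem HasExpansion.isContractiveMultiplier {S : ℍ[ℝ] → ℍ[ℝ]} {s : ℕ → ℍ[ℝ]}
    (hS : HasExpansion S s)
    (h : ∀ a : ℕ → ℍ[ℝ], Summable (fun k => ‖a k‖ ^ 2) → ∀ N : ℕ,
      ∑ n ∈ Finset.range N, ‖conv s a n‖ ^ 2 ≤ ∑' k, ‖a k‖ ^ 2) :
    IsContractiveMultiplier S := by
  rintro f ⟨a, hf, ha⟩
  have hSf := hS.starMul hf
  refine ⟨⟨_, hSf, summable_of_sum_range_le (fun _ => sq_nonneg _) (h a ha)⟩, ?_⟩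
  rw [hardyNorm, hardyNorm, hSf.coeff_eq, hf.coeff_eq]
  exact Real.sqrt_le_sqrt (Real.tsum_le_of_sum_range_le (fun _ => sq_nonneg _) (h a ha))

theorem SliceRegularOn.isContractiveMultiplier {S : ℍ[ℝ] → ℍ[ℝ]} (hS : SliceRegularOn S unitBall)
    (hb : ∀ p ∈ unitBall, ‖S p‖ ≤ 1) : IsContractiveMultiplier S := by
  obtain ⟨s, hs⟩ := hS.exists_hasExpansion
  refine hs.isContractiveMultiplier fun a ha N => ?_
  have h1 : ∀ r ∈ Set.Ico (0 : ℝ) 1,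
      ∑ n ∈ Finset.range N, ‖r ^ n • conv s a n‖ ^ 2 ≤ ∑' k, ‖a k‖ ^ 2 := by
    intro r hr
    obtain ⟨h2, h3⟩ := hs.tsum_conv_sq_le hb ha hr.1 hr.2
    refine (h2.sum_le_tsum _ fun _ _ => sq_nonneg _).trans (h3.trans ?_)
    have h4 : ∀ n, ‖r ^ n • a n‖ ^ 2 ≤ ‖a n‖ ^ 2 := fun n => by
      rw [norm_smul, norm_pow, Real.norm_eq_abs, abs_of_nonneg hr.1]
      exact pow_le_pow_left₀ (mul_nonneg (pow_nonneg hr.1 _) (norm_nonneg _))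
        (mul_le_of_le_one_left (norm_nonneg _) (pow_le_one₀ hr.1 hr.2.le)) 2
    exact (ha.of_nonneg_of_le (fun _ => sq_nonneg _) h4).tsum_le_tsum h4 ha
  -- The limit r → 1 is taken in finite partial sums, which are polynomials in r.
  have h2 : Filter.Tendsto (fun r : ℝ => ∑ n ∈ Finset.range N, ‖r ^ n • conv s a n‖ ^ 2) (𝓝[<] 1)
      (𝓝 (∑ n ∈ Finset.range N, ‖(1 : ℝ) ^ n • conv s a n‖ ^ 2)) := by
    refine Filter.Tendsto.mono_left (Continuous.tendsto ?_ 1) nhdsWithin_le_nhds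
    fun_prop
  simp only [one_pow, one_smul] at h2
  refine le_of_tendsto h2 ?_
  filter_upwards [Ico_mem_nhdsLT (zero_lt_one' ℝ)] with r hr using h1 r hr

/-! ### Square summable sequences and kernel vectors -/

/-- The real Hilbert space of square summable quaternionic sequences. -/
abbrev QuatEll2 : Type := lp (fun _ : ℕ => ℍ[ℝ]) 2

/-- A square summable sequence as an element of the Hilbert space. -/
def toEll2 (a : ℕ → ℍ[ℝ]) (ha : Summable fun k => ‖a k‖ ^ 2) : QuatEll2 :=
  ⟨a, memℓp_gen (by simpa using ha)⟩

theorem ell2_hasSum_norm_sq (a : QuatEll2) : HasSum (fun k => ‖a k‖ ^ 2) (‖a‖ ^ 2) := by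
  simpa using lp.hasSum_norm (p := 2) (by norm_num) a

theorem summable_kernel_sq (u c : ℍ[ℝ]) {q : ℍ[ℝ]} (hq : q ∈ unitBall) :
    Summable fun k => ‖u * star q ^ k * c‖ ^ 2 := by
  rw [mem_unitBall] at hq
  have h : Summable fun k => (‖q‖ ^ 2) ^ k :=
    summable_geometric_of_lt_one (by positivity) (by nlinarith [norm_nonneg q])
  refine (h.mul_left (‖u‖ ^ 2 * ‖c‖ ^ 2)).congr fun k => ?_
  rw [norm_mul, norm_mul, norm_pow, Quaternion.norm_star]
  ring

/-- The sequence `u conj(q) ^ k c`. -/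
def kernelVec (u : ℍ[ℝ]) (q : unitBall) (c : ℍ[ℝ]) : QuatEll2 :=
  toEll2 _ (summable_kernel_sq u c q.2)

theorem kernelVec_apply (u : ℍ[ℝ]) (q : unitBall) (c : ℍ[ℝ]) (k : ℕ) :
    kernelVec u q c k = u * star (q : ℍ[ℝ]) ^ k * c := rfl

theorem smul_kernelVec (r : ℝ) (u : ℍ[ℝ]) (q : unitBall) (c : ℍ[ℝ]) :
    r • kernelVec u q c = kernelVec u q (r • c) := by
  ext1
  funext k
  rw [lp.coeFn_smul, Pi.smul_apply, kernelVec_apply, kernelVec_apply, mul_smul_comm]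

theorem norm_sq_kernelVec (u : ℍ[ℝ]) (q : unitBall) (c : ℍ[ℝ]) :
    ‖kernelVec u q c‖ ^ 2 = ‖u‖ ^ 2 * ‖kernelVec 1 q c‖ ^ 2 := by
  refine (ell2_hasSum_norm_sq _).unique ?_
  have e : ∀ k, ‖kernelVec u q c k‖ ^ 2 = ‖u‖ ^ 2 * ‖kernelVec 1 q c k‖ ^ 2 := fun k => by
    rw [kernelVec_apply, kernelVec_apply, one_mul, mul_assoc, norm_mul, mul_pow]
  simp only [e]
  exact (ell2_hasSum_norm_sq (kernelVec 1 q c)).mul_left (‖u‖ ^ 2)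

theorem re_mul_comm (a b : ℍ[ℝ]) : (a * b).re = (b * a).re := by
  simp
  ring

theorem re_sum {ι : Type*} (t : Finset ι) (f : ι → ℍ[ℝ]) :
    (∑ i ∈ t, f i).re = ∑ i ∈ t, (f i).re :=
  map_sum (QuaternionAlgebra.reₗ (-1 : ℝ) 0 (-1)) f t

theorem summable_kernel_mul (u : ℍ[ℝ]) (q : unitBall) (a : QuatEll2) :
    Summable fun k => (q : ℍ[ℝ]) ^ k * u * a k := by
  have h : Summable fun k => ‖u * a k‖ ^ 2 :=
    ((ell2_hasSum_norm_sq a).summable.mul_left (‖u‖ ^ 2)).congr fun k => by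
      rw [norm_mul, mul_pow]
  simpa only [mul_assoc] using summable_pow_mul_of_summable_sq h q.2

theorem inner_kernelVec (a : QuatEll2) (u : ℍ[ℝ]) (q : unitBall) (c : ℍ[ℝ]) :
    inner ℝ a (kernelVec u q c) = (star c * ∑' k, (q : ℍ[ℝ]) ^ k * star u * a k).re := by
  refine (lp.hasSum_inner a (kernelVec u q c)).unique ?_
  have e : ∀ k, inner ℝ (a k) (kernelVec u q c k) =
      (star c * ((q : ℍ[ℝ]) ^ k * star u * a k)).re := fun k => by
    rw [Quaternion.inner_def, kernelVec_apply, re_mul_comm]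
    simp only [star_mul, star_pow, star_star, mul_assoc]
  simp only [e]
  exact ((summable_kernel_mul (star u) q a).hasSum.mul_left (star c)).map
    (QuaternionAlgebra.reₗ (-1 : ℝ) 0 (-1)) Quaternion.continuous_re

/-! ### Positivity of the kernel -/

variable {S : ℍ[ℝ] → ℍ[ℝ]}

theorem re_star_mul_schurKernel_mul (p q : unitBall) (b c : ℍ[ℝ]) :
    (star b * (schurKernel S p q * c)).re =
      inner ℝ (kernelVec 1 q c) (kernelVec 1 p b) -
        inner ℝ (kernelVec (star (S q)) q c) (kernelVec (star (S p)) p b) := by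
  have h1 := summable_kernel_mul (star 1) p (kernelVec 1 q 1)
  have h2 := summable_kernel_mul (star (star (S p))) p (kernelVec (star (S q)) q 1)
  rw [inner_kernelVec, inner_kernelVec, ← Quaternion.re_sub, ← mul_sub]
  congr 2
  have e1 : schurKernel S p q = (∑' k, (p : ℍ[ℝ]) ^ k * star 1 * kernelVec 1 q 1 k) -
      ∑' k, (p : ℍ[ℝ]) ^ k * star (star (S p)) * kernelVec (star (S q)) q 1 k := by
    rw [← h1.tsum_sub h2]
    refine tsum_congr fun k => ?_
    simp only [kernelVec_apply, star_star, star_one, mul_one, one_mul, mul_sub, sub_mul, mul_assoc]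
  rw [e1, sub_mul, ← h1.tsum_mul_right, ← h2.tsum_mul_right]
  simp only [kernelVec_apply, mul_assoc, one_mul]

theorem star_schurKernel (p q : ℍ[ℝ]) : star (schurKernel S p q) = schurKernel S q p := by
  rw [schurKernel, schurKernel, tsum_star]
  refine tsum_congr fun k => ?_
  simp [mul_assoc]

/-- The two terms of 1 - S(p) conj(S(q)) give two Gram matrices, so no regularity of S is needed. -/
theorem re_schurKernel_form {r : ℕ} (q : Fin r → unitBall) (c : Fin r → ℍ[ℝ]) :
    (star c ⬝ᵥ (Matrix.of fun i j => schurKernel S (q i) (q j)).mulVec c).re =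
      ‖∑ i, kernelVec 1 (q i) (c i)‖ ^ 2 - ‖∑ i, kernelVec (star (S (q i))) (q i) (c i)‖ ^ 2 := by
  rw [← real_inner_self_eq_norm_sq, ← real_inner_self_eq_norm_sq, inner_sum, inner_sum,
    ← Finset.sum_sub_distrib, dotProduct, re_sum]
  refine Finset.sum_congr rfl fun i _ => ?_
  rw [Matrix.mulVec, dotProduct, Finset.mul_sum, re_sum, sum_inner, sum_inner,
    ← Finset.sum_sub_distrib]
  exact Finset.sum_congr rfl fun j _ => re_star_mul_schurKernel_mul _ _ _ _

theorem isPositiveKernel_iff :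
    IsPositiveKernel unitBall (schurKernel S) ↔
      ∀ (r : ℕ) (q : Fin r → unitBall) (c : Fin r → ℍ[ℝ]),
        ‖∑ i, kernelVec (star (S (q i))) (q i) (c i)‖ ≤ ‖∑ i, kernelVec 1 (q i) (c i)‖ := by
  constructor
  · intro h r q c
    have h1 := (h r (fun i => q i) fun i => (q i).2).2 c
    rw [re_schurKernel_form] at h1
    exact le_of_sq_le_sq (by linarith) (norm_nonneg _)
  · intro h r q hq
    refine ⟨?_, fun c => ?_⟩
    · ext1 i j
      simp [star_schurKernel]
    · have h1 := re_schurKernel_form (S := S) (fun i => ⟨q i, hq i⟩) c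
      have h2 := h r (fun i => ⟨q i, hq i⟩) c
      rw [h1, sub_nonneg]
      exact pow_le_pow_left₀ (norm_nonneg _) h2 2

theorem IsPositiveKernel.norm_le_one (h : IsPositiveKernel unitBall (schurKernel S)) :
    ∀ p ∈ unitBall, ‖S p‖ ≤ 1 := by
  intro p hp
  have h1 := isPositiveKernel_iff.1 h 1 (fun _ => ⟨p, hp⟩) fun _ => 1
  rw [Fin.sum_univ_one, Fin.sum_univ_one] at h1
  have h2 := pow_le_pow_left₀ (norm_nonneg _) h1 2
  rw [norm_sq_kernelVec, Quaternion.norm_star] at h2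
  -- The zeroth entry of this vector is 1.
  have h3 : 0 < ‖kernelVec 1 ⟨p, hp⟩ 1‖ ^ 2 := by
    have h4 := le_hasSum (ell2_hasSum_norm_sq (kernelVec 1 ⟨p, hp⟩ 1)) 0 fun _ _ => sq_nonneg _
    rw [kernelVec_apply] at h4
    simp only [pow_zero, mul_one, norm_one, one_pow] at h4
    linarith
  have h5 : ‖S p‖ ^ 2 ≤ 1 := le_of_mul_le_mul_right (by rwa [one_mul]) h3
  exact (sq_le_one_iff₀ (norm_nonneg _)).1 h5

/-! ### Contractive multipliers and positive kernels -/

/-- A contractive multiplier in terms of square summable sequences. -/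
theorem isContractiveMultiplier_iff :
    IsContractiveMultiplier S ↔ ∀ a : QuatEll2, ∃ b : QuatEll2, ‖b‖ ≤ ‖a‖ ∧
      ∀ p ∈ unitBall, HasSum (fun k => p ^ k * b k) (∑' k, p ^ k * S p * a k) := by
  have norm_eq : ∀ a : QuatEll2, ‖a‖ = √(∑' k, ‖a k‖ ^ 2) := fun a => by
    rw [(ell2_hasSum_norm_sq a).tsum_eq, Real.sqrt_sq (norm_nonneg _)]
  constructor
  · intro h a
    have hf := hasExpansion_of_summable_sq (ell2_hasSum_norm_sq a).summable
    obtain ⟨⟨b, hb, hb2⟩, hle⟩ := h _ ⟨_, hf, (ell2_hasSum_norm_sq a).summable⟩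
    refine ⟨toEll2 b hb2, ?_, fun p hp => ?_⟩
    · rw [hardyNorm, hardyNorm, hb.coeff_eq, hf.coeff_eq] at hle
      rw [norm_eq, norm_eq]
      exact hle
    · have := hb p hp
      rwa [starMul, hf.coeff_eq] at this
  · rintro h f ⟨a, hf, ha⟩
    obtain ⟨b, hle, hb⟩ := h (toEll2 a ha)
    have hSf : HasExpansion (starMul S f) b := fun p hp => by
      rw [starMul, hf.coeff_eq]
      exact hb p hp
    refine ⟨⟨_, hSf, (ell2_hasSum_norm_sq b).summable⟩, ?_⟩
    rw [hardyNorm, hardyNorm, hSf.coeff_eq, hf.coeff_eq]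
    rw [norm_eq, norm_eq] at hle
    exact hle

theorem IsContractiveMultiplier.isPositiveKernel (h : IsContractiveMultiplier S) :
    IsPositiveKernel unitBall (schurKernel S) := by
  refine isPositiveKernel_iff.2 fun r q c => ?_
  set v := ∑ i, kernelVec (star (S (q i))) (q i) (c i) with hv
  set e := ∑ i, kernelVec 1 (q i) (c i) with he
  obtain ⟨b, hle, hb⟩ := isContractiveMultiplier_iff.1 h v
  -- With b the coefficients of M_S v and v = M_S* e, this is ⟪v, M_S* e⟫ = ⟪M_S v, e⟫; then ‖v‖² ≤
  -- ‖b‖ ‖e‖ ≤ ‖v‖ ‖e‖.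
  have h1 : inner ℝ v v = inner ℝ b e := by
    conv_lhs => rw [hv, inner_sum]
    rw [← hv, he, inner_sum]
    refine Finset.sum_congr rfl fun i _ => ?_
    rw [inner_kernelVec, inner_kernelVec, star_star, ← (hb _ (q i).2).tsum_eq]
    simp
  rw [real_inner_self_eq_norm_sq] at h1
  nlinarith [real_inner_le_norm b e, norm_nonneg v, norm_nonneg e, norm_nonneg b,
    mul_le_mul_of_nonneg_right hle (norm_nonneg e)]

/-- If `∑ l_i u_i ↦ ∑ l_i v_i` is contractive, then every vector `f` has a vector `g` of at most the
same norm with `⟪f, v_i⟫ = ⟪g, u_i⟫` for all `i`. -/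
theorem exists_inner_eq_inner {ι H : Type*} [NormedAddCommGroup H] [InnerProductSpace ℝ H]
    [CompleteSpace H] {u v : ι → H}
    (h : ∀ l : ι →₀ ℝ, ‖Finsupp.linearCombination ℝ v l‖ ≤ ‖Finsupp.linearCombination ℝ u l‖)
    (f : H) : ∃ g : H, ‖g‖ ≤ ‖f‖ ∧ ∀ i, inner ℝ f (v i) = inner ℝ g (u i) := by
  set U := Finsupp.linearCombination ℝ u
  set V := Finsupp.linearCombination ℝ v
  -- The functional U l ↦ ⟪f, V l⟫ is defined on the range of U through a linear section σ, then
  -- extended by Hahn–Banach and represented by Riesz.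
  obtain ⟨σ, hσ⟩ := U.rangeRestrict.exists_rightInverse_of_surjective U.range_rangeRestrict
  have hσ' : ∀ x, U (σ x) = x := fun x => congrArg Subtype.val (LinearMap.congr_fun hσ x)
  let φ : LinearMap.range U →L[ℝ] ℝ := LinearMap.mkContinuous
    ((innerSL ℝ f).toLinearMap.comp (V.comp σ)) ‖f‖ fun x => by
      refine (norm_inner_le_norm f (V (σ x))).trans
        (mul_le_mul_of_nonneg_left ((h _).trans ?_) (norm_nonneg _))
      rw [hσ']
      rfl
  have hφ : ‖φ‖ ≤ ‖f‖ := LinearMap.mkContinuous_norm_le _ (norm_nonneg _) _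
  obtain ⟨ψ, hψ, hnorm⟩ := exists_extension_norm_eq _ φ
  refine ⟨(InnerProductSpace.toDual ℝ H).symm ψ, ?_, fun i => ?_⟩
  · rw [LinearIsometryEquiv.norm_map, hnorm]
    exact hφ
  · rw [InnerProductSpace.toDual_symm_apply]
    have hu : U (Finsupp.single i 1) = u i := by simp [U]
    have hv : V (Finsupp.single i 1) = v i := by simp [V]
    have h1 := hψ (U.rangeRestrict (Finsupp.single i 1))
    -- The choice of σ is immaterial: by `h`, V vanishes on the kernel of U.
    have h2 : V (σ (U.rangeRestrict (Finsupp.single i 1)) - Finsupp.single i 1) = 0 := by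
      refine norm_le_zero_iff.1 ((h _).trans ?_)
      have : U (σ (U.rangeRestrict (Finsupp.single i 1)) - Finsupp.single i 1) = 0 := by
        rw [map_sub, hσ', sub_eq_zero]
        rfl
      exact (norm_eq_zero.2 this).le
    rw [map_sub, sub_eq_zero, hv] at h2
    rw [← hu, ← h2]
    exact h1.symm

theorem IsPositiveKernel.isContractiveMultiplier
    (h : IsPositiveKernel unitBall (schurKernel S)) : IsContractiveMultiplier S := by
  rw [isPositiveKernel_iff] at h
  refine isContractiveMultiplier_iff.2 fun a => ?_
  obtain ⟨b, hle, hb⟩ := exists_inner_eq_inner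
    (u := fun x : unitBall × ℍ[ℝ] => kernelVec 1 x.1 x.2)
    (v := fun x : unitBall × ℍ[ℝ] => kernelVec (star (S x.1)) x.1 x.2) (fun l => by
      let e := l.support.equivFin.symm
      have h1 := h _ (fun i => (e i).1.1) fun i => l (e i) • (e i).1.2
      simp only [← smul_kernelVec] at h1
      rw [Equiv.sum_comp e fun x => l x • kernelVec (star (S x.1.1)) x.1.1 x.1.2,
        Equiv.sum_comp e fun x => l x • kernelVec 1 x.1.1 x.1.2,
        Finset.sum_coe_sort l.support fun x => l x • kernelVec (star (S x.1)) x.1 x.2,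
        Finset.sum_coe_sort l.support fun x => l x • kernelVec 1 x.1 x.2] at h1
      simpa only [Finsupp.linearCombination_apply, Finsupp.sum] using h1) a
  refine ⟨b, hle, fun p hp => ?_⟩
  have hs := (summable_kernel_mul 1 ⟨p, hp⟩ b).hasSum
  simp only [mul_one] at hs
  convert hs using 1
  set x := ∑' k, p ^ k * S p * a k with hx
  set y := ∑' k, p ^ k * b k with hy
  -- The test vector c = x - y turns the identity Re(c̄ x) = Re(c̄ y) into |x - y|² = 0.
  have h2 := hb (⟨p, hp⟩, x - y)
  rw [inner_kernelVec, inner_kernelVec, star_star] at h2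
  simp only [star_one, mul_one, ← hx, ← hy] at h2
  rw [← sub_eq_zero, ← Quaternion.re_sub, ← mul_sub, Quaternion.star_mul_self, Quaternion.re_coe,
    Quaternion.normSq_eq_zero, sub_eq_zero] at h2
  exact h2

/-! ### Contractive multipliers and Toeplitz matrices -/

theorem IsContractiveMultiplier.exists_hasExpansion (h : IsContractiveMultiplier S) :
    ∃ s, HasExpansion S s := by
  -- These are the coefficients of the constant function 1, and S ⋆ 1 = S.
  have h0 : Summable fun k => ‖(Pi.single 0 1 : ℕ → ℍ[ℝ]) k‖ ^ 2 :=
    summable_of_ne_finset_zero (s := {0}) fun k hk => by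
      simp [Pi.single_eq_of_ne (Finset.notMem_singleton.1 hk)]
  obtain ⟨b, -, hb⟩ := isContractiveMultiplier_iff.1 h (toEll2 _ h0)
  refine ⟨b, fun p hp => ?_⟩
  convert hb p hp
  rw [tsum_eq_single 0 fun k hk => ?_]
  · change _ = _ * (Pi.single 0 1 : ℕ → ℍ[ℝ]) 0
    simp
  · change _ * (Pi.single 0 1 : ℕ → ℍ[ℝ]) k = 0
    rw [Pi.single_eq_of_ne hk, mul_zero]

theorem re_star_dotProduct_self {n : ℕ} (x : Fin n → ℍ[ℝ]) :
    (star x ⬝ᵥ x).re = ∑ i, ‖x i‖ ^ 2 := by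
  rw [dotProduct, re_sum]
  refine Finset.sum_congr rfl fun i _ => ?_
  rw [Pi.star_apply, Quaternion.star_mul_self, Quaternion.re_coe,
    Quaternion.normSq_eq_norm_mul_self, sq]

theorem two_mul_re_star_dotProduct_le {n : ℕ} (x y : Fin n → ℍ[ℝ]) :
    2 * (star x ⬝ᵥ y).re ≤ ∑ i, ‖x i‖ ^ 2 + ∑ i, ‖y i‖ ^ 2 := by
  rw [dotProduct, re_sum, ← Finset.sum_add_distrib, Finset.mul_sum]
  refine Finset.sum_le_sum fun i _ => ?_
  have h1 := (le_abs_self _).trans (abs_re_le_norm (star x i * y i))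
  rw [norm_mul, Pi.star_apply, Quaternion.norm_star] at h1
  rw [Pi.star_apply]
  nlinarith [sq_nonneg (‖x i‖ - ‖y i‖)]

theorem star_dotProduct_mul_conjTranspose_mulVec {n : ℕ} (A : Matrix (Fin n) (Fin n) ℍ[ℝ])
    (x : Fin n → ℍ[ℝ]) :
    star x ⬝ᵥ (A * A.conjTranspose).mulVec x =
      star (A.conjTranspose.mulVec x) ⬝ᵥ A.conjTranspose.mulVec x := by
  rw [Matrix.star_mulVec, Matrix.conjTranspose_conjTranspose, ← Matrix.mulVec_mulVec,
    Matrix.dotProduct_mulVec]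

theorem isPosSemidef_one_sub_mul_conjTranspose_iff {n : ℕ} (A : Matrix (Fin n) (Fin n) ℍ[ℝ]) :
    IsPosSemidef (1 - A * A.conjTranspose) ↔
      ∀ x : Fin n → ℍ[ℝ], ∑ i, ‖A.conjTranspose.mulVec x i‖ ^ 2 ≤ ∑ i, ‖x i‖ ^ 2 := by
  have h : ∀ x : Fin n → ℍ[ℝ], (star x ⬝ᵥ (1 - A * A.conjTranspose).mulVec x).re =
      ∑ i, ‖x i‖ ^ 2 - ∑ i, ‖A.conjTranspose.mulVec x i‖ ^ 2 := fun x => by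
    rw [Matrix.sub_mulVec, Matrix.one_mulVec, dotProduct_sub,
      star_dotProduct_mul_conjTranspose_mulVec, Quaternion.re_sub, re_star_dotProduct_self,
      re_star_dotProduct_self]
  rw [IsPosSemidef, and_iff_right
    (Matrix.isHermitian_one.sub (Matrix.isHermitian_mul_conjTranspose_self A))]
  simp only [h, sub_nonneg]

/-- From |A*x|² = Re⟨x, AA*x⟩ one gets 2|A*x|² ≤ |x|² + |AA*x|² ≤ |x|² + |A*x|². -/
theorem sum_norm_sq_conjTranspose_mulVec_le {n : ℕ} {A : Matrix (Fin n) (Fin n) ℍ[ℝ]}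
    (hA : ∀ x : Fin n → ℍ[ℝ], ∑ i, ‖A.mulVec x i‖ ^ 2 ≤ ∑ i, ‖x i‖ ^ 2) (x : Fin n → ℍ[ℝ]) :
    ∑ i, ‖A.conjTranspose.mulVec x i‖ ^ 2 ≤ ∑ i, ‖x i‖ ^ 2 := by
  have h1 := two_mul_re_star_dotProduct_le x (A.mulVec (A.conjTranspose.mulVec x))
  rw [Matrix.mulVec_mulVec, star_dotProduct_mul_conjTranspose_mulVec, re_star_dotProduct_self,
    ← Matrix.mulVec_mulVec] at h1
  linarith [hA (A.conjTranspose.mulVec x)]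

theorem isPosSemidef_one_sub_iff {n : ℕ} (A : Matrix (Fin n) (Fin n) ℍ[ℝ]) :
    IsPosSemidef (1 - A * A.conjTranspose) ↔
      ∀ x : Fin n → ℍ[ℝ], ∑ i, ‖A.mulVec x i‖ ^ 2 ≤ ∑ i, ‖x i‖ ^ 2 := by
  rw [isPosSemidef_one_sub_mul_conjTranspose_iff]
  refine ⟨fun h x => ?_, sum_norm_sq_conjTranspose_mulVec_le⟩
  simpa using sum_norm_sq_conjTranspose_mulVec_le h x

theorem toeplitz_mulVec (s a : ℕ → ℍ[ℝ]) (n : ℕ) (i : Fin (n + 1)) :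
    (toeplitz s n).mulVec (fun j => a j) i = conv s a i := by
  have h1 : (toeplitz s n).mulVec (fun j => a j) i =
      ∑ j ∈ Finset.range (n + 1), if j ≤ i then s (i - j) * a j else 0 := by
    rw [Finset.sum_range, Matrix.mulVec, dotProduct]
    refine Finset.sum_congr rfl fun j _ => ?_
    by_cases hj : j ≤ i
    · simp [toeplitz, hj]
    · simp [toeplitz, hj]
  rw [h1, conv, ← Finset.sum_filter, ← Finset.Nat.sum_antidiagonal_swap]
  simp only [Prod.fst_swap, Prod.snd_swap]
  rw [Finset.Nat.sum_antidiagonal_eq_sum_range_succ fun k l => s l * a k]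
  refine Finset.sum_congr ?_ fun _ _ => rfl
  ext j
  simp only [Finset.mem_filter, Finset.mem_range]
  omega

theorem HasExpansion.isContractiveMultiplier_of_toeplitz {s : ℕ → ℍ[ℝ]} (hS : HasExpansion S s)
    (h : ∀ n, IsPosSemidef (1 - toeplitz s n * (toeplitz s n).conjTranspose)) :
    IsContractiveMultiplier S := by
  refine hS.isContractiveMultiplier fun a ha N => ?_
  -- The matrix of index N has N + 1 rows, one more than the partial sum needs.
  have h1 := (isPosSemidef_one_sub_iff _).1 (h N) fun j => a j
  simp only [toeplitz_mulVec] at h1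
  rw [← Finset.sum_range fun i => ‖conv s a i‖ ^ 2, ← Finset.sum_range fun i => ‖a i‖ ^ 2] at h1
  refine le_trans ?_ (h1.trans (ha.sum_le_tsum _ fun _ _ => sq_nonneg _))
  exact Finset.sum_le_sum_of_subset_of_nonneg (Finset.range_mono N.le_succ)
    fun _ _ _ => sq_nonneg _

theorem IsContractiveMultiplier.isPosSemidef_toeplitz {s : ℕ → ℍ[ℝ]}
    (h : IsContractiveMultiplier S) (hS : HasExpansion S s) (n : ℕ) :
    IsPosSemidef (1 - toeplitz s n * (toeplitz s n).conjTranspose) := by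
  refine (isPosSemidef_one_sub_iff _).2 fun x => ?_
  -- Extension by zero preserves the norm, and the first n + 1 entries of the Cauchy product depend
  -- only on x.
  let a : ℕ → ℍ[ℝ] := fun k => if hk : k < n + 1 then x ⟨k, hk⟩ else 0
  have hx : x = fun j : Fin (n + 1) => a j := by
    funext j
    simp only [a, dif_pos j.2, Fin.eta]
  have ha0 : ∀ k ∉ Finset.range (n + 1), ‖a k‖ ^ 2 = 0 := fun k hk => by
    have hk' : a k = 0 := dif_neg (Finset.mem_range.not.1 hk)
    rw [hk', norm_zero, sq, mul_zero]
  have ha : Summable fun k => ‖a k‖ ^ 2 := summable_of_ne_finset_zero ha0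
  obtain ⟨b, hle, hb⟩ := isContractiveMultiplier_iff.1 h (toEll2 a ha)
  have hbc : (b : ℕ → ℍ[ℝ]) = conv s a := by
    refine HasExpansion.unique (f := fun p => ∑' k, p ^ k * S p * a k) hb fun p hp => ?_
    exact hS.hasSum_conv (hasExpansion_of_summable_sq ha) hp
  have h1 := pow_le_pow_left₀ (norm_nonneg _) hle 2
  rw [hx]
  simp only [toeplitz_mulVec]
  rw [← Finset.sum_range fun i => ‖conv s a i‖ ^ 2, ← Finset.sum_range fun i => ‖a i‖ ^ 2,
    ← hbc, ← tsum_eq_sum (L := SummationFilter.unconditional ℕ) (fun k hk => ha0 k hk)]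
  refine (sum_le_hasSum _ (fun _ _ => sq_nonneg _) (ell2_hasSum_norm_sq b)).trans (h1.trans ?_)
  exact (ell2_hasSum_norm_sq (toEll2 a ha)).tsum_eq.ge

end QuatHardy

end

theorem theoremT (S : ℍ[ℝ] → ℍ[ℝ]) :
    List.TFAE [
      QuatHardy.SliceRegularOn S QuatHardy.unitBall ∧ ∀ p ∈ QuatHardy.unitBall, ‖S p‖ ≤ 1,
      QuatHardy.IsContractiveMultiplier S,
      QuatHardy.IsPositiveKernel QuatHardy.unitBall (QuatHardy.schurKernel S),
      QuatHardy.SliceRegularOn S QuatHardy.unitBall ∧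
        ∀ n : ℕ, QuatHardy.IsPosSemidef
          (1 - QuatHardy.toeplitz (QuatHardy.coeff S) n *
            (QuatHardy.toeplitz (QuatHardy.coeff S) n).conjTranspose)] := by
  tfae_have 1 → 2 := fun h => h.1.isContractiveMultiplier h.2
  tfae_have 2 → 1 := fun h => by
    obtain ⟨s, hs⟩ := h.exists_hasExpansion
    exact ⟨hs.sliceRegularOn, h.isPositiveKernel.norm_le_one⟩
  tfae_have 2 → 3 := fun h => h.isPositiveKernel
  tfae_have 3 → 2 := fun h => h.isContractiveMultiplier
  tfae_have 2 → 4 := fun h => by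
    obtain ⟨s, hs⟩ := h.exists_hasExpansion
    rw [hs.coeff_eq]
    exact ⟨hs.sliceRegularOn, h.isPosSemidef_toeplitz hs⟩
  tfae_have 4 → 2 := fun ⟨hS, h⟩ => by
    obtain ⟨s, hs⟩ := hS.exists_hasExpansion
    rw [hs.coeff_eq] at h
    exact hs.isContractiveMultiplier_of_toeplitz h
  tfae_finish
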